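/- There are absolute constants $c_0,c>0$ such that the following holds. Let $d\ge 2$ and $n\ge 1$ be integers, $\alpha\in(0,\tfrac12)$, $\varepsilon>0$, $\delta\in[0,1]$, and suppose $\delta\log(d/\delta)\le c_0\,\alpha^2\varepsilon^2/d$ (the left side being $0$ for $\delta=0$). Let $M$ be an online algorithm on data in $\{\pm1\}^d$: a randomized map $M_1$ sends $x_1$ to an internal state $s_1$ in a measurable space $\mathcal I$, randomized maps $M_i$ send $(x_i,s_{i-1})$ to $s_i$ for $2\le i\le n$, and a randomized map $M_{\mathcal O}$ sends the final state $s_n$ to an output in $[-1,1]^d$. Suppose that $M$ satisfies both of the following. (i) $M$ is $(\varepsilon,\delta)$-pan-private on streams of length $n$: for all $\vec x,\vec x'\in(\{\pm1\}^d)^n$ that differ in at most one element, every $t\in\{1,\dots,n\}$ and every measurable $T\subseteq\mathcal I\times[-1,1]^d$, $$\Pr[(s_t(\vec x),M(\vec x))\in T]\le e^{\varepsilon}\Pr[(s_t(\vec x'),M(\vec x'))\in T]+\delta,$$ where $s_t(\vec x)$ is the internal state after the first $t$ elements of $\vec x$ and $M(\vec x)$ is the output on $\vec x$, in the same run of $M$.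 (ii) $M$ solves $(d,1,\alpha)$-sparse mean estimation with $n$ samples: for every probability distribution $\mathbf P$ on $\{\pm1\}^d$ whose mean $\vec\mu$ has at most one nonzero coordinate, on input of $n$ independent samples from $\mathbf P$ the output $\vec V$ of $M$ satisfies $\|\vec V-\vec\mu\|_\infty\le\alpha$ with probability at least $99/100$ over the samples and the randomness of $M$. Then $$n\ \ge\ c\,\frac{\sqrt d}{\alpha\varepsilon}.$$ -/

import Mathlib

open MeasureTheory ProbabilityTheory

noncomputable section

/-- An online algorithm with data universe `X`, internal states `S` and outputs `O`: the first
internal algorithm maps the first data point to a state, `next i` maps the data point at position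
`i + 1` and the state reached after `i` data points to a new state (`i ≥ 1`; `next 0` is never
used), and `out` maps the final state to the output. Randomized maps are Markov kernels. -/
structure OnlineAlgorithm (X S O : Type*) [MeasurableSpace X] [MeasurableSpace S]
    [MeasurableSpace O] where
  first : Kernel X S
  next : ℕ → Kernel (X × S) S
  out : Kernel S O
  markov_first : IsMarkovKernel first
  markov_next : ∀ i, IsMarkovKernel (next i)
  markov_out : IsMarkovKernel out

namespace OnlineAlgorithm

variable {X S O : Type*} [MeasurableSpace X] [MeasurableSpace S] [MeasurableSpace O]

/-- `M.evolve i l s` is the law of the internal state after processing the further data points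
`l`, starting from the state `s` reached after the first `i` data points. -/
def evolve (M : OnlineAlgorithm X S O) : ℕ → List X → Kernel S S
  | _, [] => Kernel.id
  | i, x :: l => M.evolve (i + 1) l ∘ₖ (M.next i).comap (fun s => (x, s)) measurable_prodMk_left

/-- The law of the internal state after processing a nonempty stream. There is no internal state
before the first data point; the value for the empty stream is a placeholder. -/
def stateLaw (M : OnlineAlgorithm X S O) : List X → Measure S
  | [] => 0
  | x :: l => M.evolve 1 l ∘ₘ M.first x

/-- The law of the output on a nonempty stream. -/
def outputLaw (M : OnlineAlgorithm X S O) (l : List X) : Measure O :=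
  M.out ∘ₘ M.stateLaw l

/-- The joint law of the internal state after the first `t` data points of the stream `l` and of
the final output on `l`, for `1 ≤ t ≤ l.length`. -/
def viewLaw (M : OnlineAlgorithm X S O) (l : List X) (t : ℕ) : Measure (S × O) :=
  M.stateLaw (l.take t) ⊗ₘ (M.out ∘ₖ M.evolve t (l.drop t))

/-- `(ε, δ)`-pan-privacy on streams of length `n`: neighboring streams (differing in at most one
element) give `(ε, δ)`-indistinguishable pairs (internal state at time `t`, final output), for
every single time `t`. -/
def IsPanPrivate [DecidableEq X] (M : OnlineAlgorithm X S O) (n : ℕ) (ε δ : ℝ) : Prop :=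
  ∀ x x' : Fin n → X, hammingDist x x' ≤ 1 → ∀ t : ℕ, 1 ≤ t → t ≤ n →
    ∀ T : Set (S × O), MeasurableSet T →
      M.viewLaw (List.ofFn x) t T ≤
        ENNReal.ofReal (Real.exp ε) * M.viewLaw (List.ofFn x') t T + ENNReal.ofReal δ

theorem isMarkovKernel_evolve (M : OnlineAlgorithm X S O) (l : List X) (i : ℕ) :
    IsMarkovKernel (M.evolve i l) := by
  induction l generalizing i with
  | nil => unfold evolve; infer_instance
  | cons x l ih =>
    have := ih (i + 1)
    have := M.markov_next i
    unfold evolve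
    infer_instance

theorem isProbabilityMeasure_stateLaw (M : OnlineAlgorithm X S O) {l : List X} (hl : l ≠ []) :
    IsProbabilityMeasure (M.stateLaw l) := by
  cases l with
  | nil => exact absurd rfl hl
  | cons x l =>
    have := M.isMarkovKernel_evolve l 1
    have := M.markov_first
    unfold stateLaw
    infer_instance

end OnlineAlgorithm

/-- The hypercube `{-1, 1}^d`; the two units of `ℤ` are `1` and `-1`. -/
abbrev SignCube (d : ℕ) : Type := Fin d → ℤˣ

instance instMeasurableSingletonClassIntUnits : MeasurableSingletonClass ℤˣ :=
  ⟨fun a => ⟨{(a : ℤ)}, MeasurableSet.singleton _, by ext; simp [Units.ext_iff]⟩⟩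

/-- The mean vector of a distribution on `{-1, 1}^d`. -/
def signMean {d : ℕ} (P : Measure (SignCube d)) : Fin d → ℝ :=
  fun i => ∫ x, ((x i : ℤ) : ℝ) ∂P

/-- `M` solves `(d, k, α)`-sparse mean estimation with `n` samples: for every distribution `P` on
`{-1, 1}^d` whose mean has at most `k` nonzero coordinates, on `n` independent samples from `P`
the output in `[-1, 1]^d` is within `α` of the mean in sup norm (the norm of `Fin d → ℝ`) with
probability at least `99/100` over the samples and the randomness of `M`. -/
def SolvesSparseMean {S : Type*} [MeasurableSpace S] {d : ℕ}
    (M : OnlineAlgorithm (SignCube d) S (Fin d → Set.Icc (-1 : ℝ) 1)) (k : ℕ) (α : ℝ) (n : ℕ) :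
    Prop :=
  ∀ P : Measure (SignCube d), IsProbabilityMeasure P →
    (Function.support (signMean P)).ncard ≤ k →
    99 / 100 ≤ ∫⁻ x, M.outputLaw (List.ofFn x)
        {v | ‖signMean P - (fun i => (v i : ℝ))‖ ≤ α} ∂(Measure.pi fun _ : Fin n => P)

end

/-! Let `U` be uniform on the cube, and let `P_{j,b}` be the distribution whose `j`-th coordinate
has mean `2αb`, the others being fair independent signs. On samples from `P_{j,b}` an accurate
output has `b * v j ≥ α` with probability at least 99/100. On samples from `U` the events for `b =
1` and `b = -1` are disjoint, so their probabilities add up to at most 1. Summed over the `2d` pairs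
`(j, b)`, passing from `U` to `P_{j,b}` therefore raises the success probabilities by at least
`(99/50 - 1) d = (49/50) d` (`SolvesSparseMean.le_streamSum`,
`SolvesSparseMean.le_of_isPanPrivate`).

This gain is spread over `n` hybrid steps (`streamSum_sub_eq_sum_hybrid`), each of which changes the
law of one element `x`, with uniform elements before it and `P_{j,b}` elements after it. As the
prefix is uniform, the law of the state just after `x` is the same function of `x` for all `(j, b)`;
only the success probability continued from that state depends on the pair. The densities differ by
`2αb x_j / 2^d`, so the total gain of a step is `2α` times the mean of `∑ j, x_j g_j(s)`, where `x`
is uniform, `s` is the state after `x`, and `|g_j| ≤ 1` (`sum_hybrid_le`).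

If `s` were independent of `x`, this sum would have mean 0 and subgaussian fluctuations of order
`√d`. By pan-privacy the law of `s` changes by at most `(ε, δ)` with `x`, so the mean is `O(ε√d +
δd)` (`sum_signs_integral_le`). Hence `d ≲ nα(ε√d + δd)`, and the smallness of `δ` absorbs the
second term. -/

/-! ### Averages over streams of independent elements -/

/-- The sum of `f` over all streams of length `m`, weighted by the product weights of `p`. -/
noncomputable def streamSum {X : Type*} [Fintype X] (p : X → ℝ) : ℕ → (List X → ℝ) → ℝ
  | 0, f => f []
  | m + 1, f => ∑ x, p x * streamSum p m (fun l => f (x :: l))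

section StreamSum

variable {X : Type*} [Fintype X] (p : X → ℝ)

/-- The recursion peels off the head of the stream, whereas the hybrid argument changes the element
at the end of a prefix. -/
theorem streamSum_succ_last (m : ℕ) (f : List X → ℝ) :
    streamSum p (m + 1) f = streamSum p m (fun l => ∑ x, p x * f (l ++ [x])) := by
  induction m generalizing f with
  | zero => simp [streamSum]
  | succ m ih =>
    change ∑ x, p x * streamSum p (m + 1) (fun l => f (x :: l)) =
      ∑ x, p x * streamSum p m (fun l => ∑ y, p y * f (x :: l ++ [y]))
    simp only [ih, List.cons_append]

theorem streamSum_sub (m : ℕ) (f g : List X → ℝ) :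
    streamSum p m (fun l => f l - g l) = streamSum p m f - streamSum p m g := by
  induction m generalizing f g with
  | zero => rfl
  | succ m ih => simp only [streamSum, ih, mul_sub, Finset.sum_sub_distrib]

theorem streamSum_sum {ι : Type*} (s : Finset ι) (m : ℕ) (f : ι → List X → ℝ) :
    streamSum p m (fun l => ∑ i ∈ s, f i l) = ∑ i ∈ s, streamSum p m (f i) := by
  induction m generalizing f with
  | zero => rfl
  | succ m ih =>
    simp only [streamSum, ih, Finset.mul_sum]
    exact Finset.sum_comm

theorem streamSum_mono {p : X → ℝ} (hp : ∀ x, 0 ≤ p x) {m : ℕ} {f g : List X → ℝ}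
    (h : ∀ l, l.length = m → f l ≤ g l) : streamSum p m f ≤ streamSum p m g := by
  induction m generalizing f g with
  | zero => exact h [] rfl
  | succ m ih =>
    exact Finset.sum_le_sum fun x _ => mul_le_mul_of_nonneg_left
      (ih fun l hl => h (x :: l) (by simp [hl])) (hp x)

theorem streamSum_const {p : X → ℝ} (hp : ∑ x, p x = 1) (m : ℕ) (a : ℝ) :
    streamSum p m (fun _ => a) = a := by
  induction m with
  | zero => rfl
  | succ m ih => simp only [streamSum, ih, ← Finset.sum_mul, hp, one_mul]

theorem streamSum_congr {m : ℕ} {f g : List X → ℝ} (h : ∀ l, l.length = m → f l = g l) :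
    streamSum p m f = streamSum p m g := by
  induction m generalizing f g with
  | zero => exact h [] rfl
  | succ m ih =>
    exact Finset.sum_congr rfl fun x _ => by rw [ih fun l hl => h (x :: l) (by simp [hl])]

theorem streamSum_eq_sum (m : ℕ) (f : List X → ℝ) :
    streamSum p m f = ∑ x : Fin m → X, (∏ i, p (x i)) * f (List.ofFn x) := by
  induction m generalizing f with
  | zero => simp [streamSum]
  | succ m ih =>
    rw [← (Fin.consEquiv fun _ : Fin (m + 1) => X).sum_comp, Fintype.sum_prod_type]
    simp only [streamSum, ih, Finset.mul_sum, Fin.consEquiv_apply, Fin.prod_univ_succ,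
      Fin.cons_zero, Fin.cons_succ, List.ofFn_succ, mul_assoc]

theorem measurable_streamSum {S : Type*} [MeasurableSpace S] {m : ℕ} {f : List X → S → ℝ}
    (hf : ∀ l, Measurable (f l)) : Measurable fun s => streamSum p m (fun l => f l s) := by
  induction m generalizing f with
  | zero => exact hf []
  | succ m ih =>
    exact Finset.measurable_sum _ fun x _ => (ih fun l => hf (x :: l)).const_mul _

theorem integrable_streamSum {S : Type*} [MeasurableSpace S] {μ : Measure S} {m : ℕ}
    {f : List X → S → ℝ} (hf : ∀ l, Integrable (f l) μ) :
    Integrable (fun s => streamSum p m (fun l => f l s)) μ := by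
  induction m generalizing f with
  | zero => exact hf []
  | succ m ih =>
    exact integrable_finsetSum _ fun x _ => (ih fun l => hf (x :: l)).const_mul _

theorem streamSum_integral {S : Type*} [MeasurableSpace S] {μ : Measure S} {m : ℕ}
    {f : List X → S → ℝ} (hf : ∀ l, Integrable (f l) μ) :
    streamSum p m (fun l => ∫ s, f l s ∂μ) = ∫ s, streamSum p m (fun l => f l s) ∂μ := by
  induction m generalizing f with
  | zero => rfl
  | succ m ih =>
    simp only [streamSum]
    rw [integral_finsetSum _ fun x _ =>
      (integrable_streamSum p fun l => hf (x :: l)).const_mul _]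
    simp only [integral_const_mul, ih fun l => hf (_ :: l)]

/-- Replacing the weights `u` by `p`, one position of the stream at a time. -/
theorem streamSum_sub_eq_sum_hybrid (u : X → ℝ) (n : ℕ) (f : List X → ℝ) :
    streamSum p n f - streamSum u n f = ∑ t ∈ Finset.range n, streamSum u t (fun l =>
      ∑ x, (p x - u x) * streamSum p (n - 1 - t) (fun l' => f ((l ++ [x]) ++ l'))) := by
  have key := Finset.sum_range_sub'
    (fun t => streamSum u t (fun l => streamSum p (n - t) (fun l' => f (l ++ l')))) n
  have hlast : streamSum u n (fun l => streamSum p (n - n) (fun l' => f (l ++ l'))) =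
      streamSum u n f := by simp only [Nat.sub_self, streamSum, List.append_nil]
  rw [hlast] at key
  refine Eq.trans key.symm ?_
  refine Finset.sum_congr rfl fun t ht => ?_
  have ht' : n - t = (n - 1 - t) + 1 := by have := Finset.mem_range.1 ht; omega
  rw [streamSum_succ_last, ← streamSum_sub, ht', show n - (t + 1) = n - 1 - t by omega]
  refine streamSum_congr _ fun l _ => ?_
  simp only [streamSum, sub_mul, Finset.sum_sub_distrib, List.append_assoc, List.singleton_append]

theorem streamSum_mem_Icc {p : X → ℝ} (hp : ∀ x, 0 ≤ p x) (hp1 : ∑ x, p x = 1) {m : ℕ}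
    {f : List X → ℝ} (hf : ∀ l, f l ∈ Set.Icc 0 1) : streamSum p m f ∈ Set.Icc 0 1 := by
  constructor
  · rw [← streamSum_const hp1 m 0]
    exact streamSum_mono hp fun l _ => (hf l).1
  · rw [← streamSum_const hp1 m 1]
    exact streamSum_mono hp fun l _ => (hf l).2

end StreamSum

/-! ### Approximate indistinguishability and sign vectors -/

/-- Layer-cake formula: the hypothesis is applied to each level set `{t < f}`. The level sets with
`t > B` are empty, so `δ` is paid only over an interval of length `B`. -/
theorem integral_le_of_measure_le {S : Type*} [MeasurableSpace S] {μ ν : Measure S}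
    [IsFiniteMeasure μ] [IsFiniteMeasure ν] {ε δ : ℝ} (hδ : 0 ≤ δ)
    (h : ∀ A, MeasurableSet A →
      μ A ≤ ENNReal.ofReal (Real.exp ε) * ν A + ENNReal.ofReal δ)
    {f : S → ℝ} (hf : Measurable f) {B : ℝ} (hB0 : 0 ≤ B)
    (h0 : ∀ s, 0 ≤ f s) (hB : ∀ s, f s ≤ B) :
    ∫ s, f s ∂μ ≤ Real.exp ε * ∫ s, f s ∂ν + δ * B := by
  have hν : Integrable f ν := Integrable.of_bound hf.aestronglyMeasurable B
    (.of_forall fun s => by rw [Real.norm_of_nonneg (h0 s)]; exact hB s)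
  have hμ : Integrable f μ := Integrable.of_bound hf.aestronglyMeasurable B
    (.of_forall fun s => by rw [Real.norm_of_nonneg (h0 s)]; exact hB s)
  have key : ∫⁻ s, ENNReal.ofReal (f s) ∂μ ≤
      ENNReal.ofReal (Real.exp ε) * ∫⁻ s, ENNReal.ofReal (f s) ∂ν
        + ENNReal.ofReal δ * ENNReal.ofReal B := by
    rw [lintegral_eq_lintegral_meas_lt μ (.of_forall h0) hf.aemeasurable,
      lintegral_eq_lintegral_meas_lt ν (.of_forall h0) hf.aemeasurable]
    calc ∫⁻ t in Set.Ioi 0, μ {a | t < f a}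
        ≤ ∫⁻ t in Set.Ioi 0, (ENNReal.ofReal (Real.exp ε) * ν {a | t < f a} +
            (Set.Iic B).indicator (fun _ => ENNReal.ofReal δ) t) := by
          refine lintegral_mono fun t => ?_
          rcases le_or_gt t B with ht | ht
          · rw [Set.indicator_of_mem (by exact ht)]
            exact h _ (measurableSet_lt measurable_const hf)
          · have : {a | t < f a} = ∅ := by
              ext a; simpa using (hB a).trans ht.le
            simp [this]
      _ = _ := by
          rw [lintegral_add_right _ (measurable_const.indicator measurableSet_Iic),
            lintegral_const_mul' _ _ ENNReal.ofReal_ne_top,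
            lintegral_indicator_const measurableSet_Iic,
            Measure.restrict_apply measurableSet_Iic, Set.Iic_inter_Ioi, Real.volume_Ioc, sub_zero]
  rw [← ofReal_integral_eq_lintegral_ofReal hμ (.of_forall h0),
    ← ofReal_integral_eq_lintegral_ofReal hν (.of_forall h0),
    ← ENNReal.ofReal_mul (Real.exp_pos _).le, ← ENNReal.ofReal_mul hδ,
    ← ENNReal.ofReal_add (mul_nonneg (Real.exp_pos _).le (integral_nonneg h0))
      (mul_nonneg hδ hB0)] at key
  exact (ENNReal.ofReal_le_ofReal_iff (add_nonneg
    (mul_nonneg (Real.exp_pos _).le (integral_nonneg h0)) (mul_nonneg hδ hB0))).1 key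

theorem sum_signs_exp_eq_prod {d : ℕ} (a : Fin d → ℝ) :
    ∑ x : SignCube d, Real.exp (∑ j, ((x j : ℤ) : ℝ) * a j) = ∏ j, (2 * Real.cosh (a j)) := by
  simp only [Real.exp_sum]
  have := Finset.prod_univ_sum (fun _ : Fin d => (Finset.univ : Finset ℤˣ))
    (fun j b => Real.exp (((b : ℤ) : ℝ) * a j))
  rw [Fintype.piFinset_univ] at this
  rw [← this]
  refine Finset.prod_congr rfl fun j _ => ?_
  rw [UnitsInt.univ, Finset.sum_pair (by decide), Real.cosh_eq]
  simp
  ring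

theorem card_signCube (d : ℕ) : (Fintype.card (SignCube d) : ℝ) = 2 ^ d := by
  simp [SignCube]

/-- Independent signs are subgaussian: each factor satisfies `cosh (g j / √d) ≤ exp (1 / (2d))`, and
the product of the `d` bounds is `√e < 2`. At scale `√d` the exponential moment is thus an absolute
constant. -/
theorem sum_signs_exp_le {d : ℕ} (hd : 1 ≤ d) (g : Fin d → ℝ) (hg : ∀ j, |g j| ≤ 1) :
    ∑ x : SignCube d, Real.exp ((∑ j, ((x j : ℤ) : ℝ) * g j) / √d) ≤ 2 ^ d * 2 := by
  have hd0 : (0 : ℝ) < d := by exact_mod_cast hd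
  have hs : ∀ x : SignCube d, (∑ j, ((x j : ℤ) : ℝ) * g j) / √d
      = ∑ j, ((x j : ℤ) : ℝ) * (g j / √d) := fun x => by
    rw [Finset.sum_div]; simp only [mul_div_assoc]
  simp only [hs]
  rw [sum_signs_exp_eq_prod]
  calc ∏ j, (2 * Real.cosh (g j / √d)) ≤ ∏ _j : Fin d, (2 * Real.exp (1 / d / 2)) := by
        refine Finset.prod_le_prod (fun j _ => by positivity) fun j _ => ?_
        refine mul_le_mul_of_nonneg_left ((Real.cosh_le_exp_half_sq _).trans ?_) two_pos.le
        refine Real.exp_le_exp.2 ?_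
        rw [div_pow, Real.sq_sqrt hd0.le]
        have : g j ^ 2 ≤ 1 := by rw [← sq_abs]; exact pow_le_one₀ (abs_nonneg _) (hg j)
        gcongr
    _ = 2 ^ d * Real.exp (1 / 2) := by
        rw [Finset.prod_const, Finset.card_univ, Fintype.card_fin, mul_pow, ← Real.exp_nat_mul]
        congr 2
        field_simp
    _ ≤ 2 ^ d * 2 := by
        refine mul_le_mul_of_nonneg_left ?_ (by positivity)
        have h := Real.exp_one_lt_d9
        have h2 : Real.exp (1 / 2) ^ 2 = Real.exp 1 := by rw [← Real.exp_nat_mul]; norm_num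
        nlinarith [Real.exp_pos (1 / 2)]

theorem sum_signs_eq_zero {d : ℕ} (j : Fin d) :
    ∑ x : SignCube d, ((x j : ℤ) : ℝ) = 0 := by
  have h := Equiv.sum_comp (Equiv.neg (SignCube d)) (fun x : SignCube d => ((x j : ℤ) : ℝ))
  simp only [Equiv.neg_apply, Pi.neg_apply, Units.val_neg, Int.cast_neg,
    Finset.sum_neg_distrib] at h
  linarith

theorem abs_sign_cast (b : ℤˣ) : |((b : ℤ) : ℝ)| = 1 := by
  rcases Int.units_eq_one_or b with rfl | rfl <;> simp

/-- Approximately indistinguishable laws indexed by the hypercube correlate little with most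
coordinates of the index. -/
theorem sum_signs_integral_le {d : ℕ} (hd : 1 ≤ d) {S : Type*} [MeasurableSpace S]
    {μ : SignCube d → Measure S} [∀ x, IsProbabilityMeasure (μ x)] {ε δ : ℝ} (hε : 0 < ε)
    (hδ : 0 ≤ δ)
    (h : ∀ x y A, MeasurableSet A →
      μ x A ≤ ENNReal.ofReal (Real.exp ε) * μ y A + ENNReal.ofReal δ)
    {g : Fin d → S → ℝ} (hg : ∀ j, Measurable (g j)) (hg1 : ∀ j s, |g j s| ≤ 1) :
    ∑ x, ∑ j, ((x j : ℤ) : ℝ) * ∫ s, g j s ∂μ x ≤ 2 ^ d * (4 * ε * √d + 2 * δ * d) := by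
  have hd0 : (0 : ℝ) < d := by exact_mod_cast hd
  have hr : 0 < √(d : ℝ) := Real.sqrt_pos.2 hd0
  set F : SignCube d → S → ℝ := fun x s => ∑ j, ((x j : ℤ) : ℝ) * g j s with hF
  have hFm : ∀ x, Measurable (F x) := fun x =>
    Finset.measurable_sum _ fun j _ => (hg j).const_mul _
  have hFb : ∀ x s, |F x s| ≤ d := fun x s => by
    refine (Finset.abs_sum_le_sum_abs _ _).trans ?_
    calc ∑ j, |((x j : ℤ) : ℝ) * g j s| ≤ ∑ _j : Fin d, (1 : ℝ) :=
          Finset.sum_le_sum fun j _ => by rw [abs_mul, abs_sign_cast, one_mul]; exact hg1 j s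
      _ = d := by simp
  have bdd : ∀ (f : S → ℝ) (B : ℝ) (x : SignCube d), Measurable f → (∀ s, |f s| ≤ B) →
      Integrable f (μ x) := fun f B x hf hB =>
    Integrable.of_bound hf.aestronglyMeasurable B (.of_forall hB)
  have hgi : ∀ j x, Integrable (g j) (μ x) := fun j x => bdd _ 1 x (hg j) (hg1 j)
  have hFi : ∀ x y, Integrable (F x) (μ y) := fun x y => bdd _ d y (hFm x) (hFb x)
  have hEm : ∀ x, Measurable fun s => Real.exp (F x s / √d) := fun x =>
    ((hFm x).div_const _).exp
  have hEi : ∀ x y, Integrable (fun s => Real.exp (F x s / √d)) (μ y) := fun x y =>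
    bdd _ (Real.exp (d / √d)) y (hEm x) fun s => by
      rw [abs_of_pos (Real.exp_pos _)]
      have := (abs_le.1 (hFb x s)).2
      gcongr
  -- The law at the all-ones vector `1` serves as reference. It does not depend on `x`, so the sum
  -- over `x` can be taken pointwise in `s`.
  have hEsum : ∑ x, ∫ s, Real.exp (F x s / √d) ∂μ 1 ≤ 2 ^ d * 2 := by
    rw [← integral_finsetSum _ fun x _ => hEi x 1]
    calc _ ≤ ∫ _s, (2 ^ d * 2 : ℝ) ∂μ 1 :=
          integral_mono (integrable_finsetSum _ fun x _ => hEi x 1) (integrable_const _)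
            fun s => sum_signs_exp_le hd (fun j => g j s) (fun j => hg1 j s)
      _ = _ := by simp
  have hswap : ∀ x, ∑ j, ((x j : ℤ) : ℝ) * ∫ s, g j s ∂μ x = ∫ s, F x s ∂μ x := fun x => by
    rw [integral_finsetSum _ fun j _ => (hgi j x).const_mul _]
    simp only [integral_const_mul]
  simp only [hswap]
  have hposm : ∀ x, Measurable fun s => max (F x s) 0 := fun x => (hFm x).max measurable_const
  have hcard := card_signCube d
  -- For `ε ≤ 1` the factor `exp ε - 1` is at most `2ε` and the mean-zero cancellation is used. For
  -- `ε ≥ 1` that factor is too large; instead the part of `F` below `ε√d` is bounded trivially.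
  rcases le_total ε 1 with hε1 | hε1
  · have hFneg : ∀ x s, F (-x) s = -F x s := fun x s => by simp [hF]
    have hexp : Real.exp ε - 1 ≤ 2 * ε := by
      have := Real.abs_exp_sub_one_le (x := ε) (by rwa [abs_of_pos hε])
      rw [abs_of_pos hε] at this
      exact (le_abs_self _).trans this
    have hone : 1 ≤ Real.exp ε := Real.one_le_exp hε.le
    have hzero : ∑ x, ∫ s, F x s ∂μ 1 = 0 := by
      rw [← integral_finsetSum _ fun x _ => hFi x 1]
      refine integral_eq_zero_of_ae (.of_forall fun s => ?_)
      simp only [hF, Pi.zero_apply]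
      rw [Finset.sum_comm]
      simp only [← Finset.sum_mul, sum_signs_eq_zero, zero_mul, Finset.sum_const_zero]
    -- Positive and negative parts are transferred from `μ x` to `μ 1` separately, at a cost of
    -- `(exp ε - 1) ∫ |F x| ∂μ 1 + 2δd`. Then `|y| ≤ sinh |y| ≤ cosh y` with `y = F x s / √d` brings
    -- in the exponential moments.
    have step : ∀ x, ∫ s, F x s ∂μ x ≤ ∫ s, F x s ∂μ 1 +
        2 * ε * (√d * ((∫ s, Real.exp (F x s / √d) ∂μ 1
          + ∫ s, Real.exp (F (-x) s / √d) ∂μ 1) / 2)) + 2 * δ * d := fun x => by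
      have hpi : ∀ z y, Integrable (fun s => max (F z s) 0) (μ y) := fun z y =>
        bdd _ d y (hposm z) fun s => by
          rw [abs_of_nonneg (le_max_right _ _)]
          exact max_le ((le_abs_self _).trans (hFb z s)) hd0.le
      have dec : ∀ y, ∫ s, F x s ∂μ y = ∫ s, max (F x s) 0 ∂μ y - ∫ s, max (F (-x) s) 0 ∂μ y :=
        fun y => by
          rw [← integral_sub (hpi x y) (hpi (-x) y)]
          refine integral_congr_ae (.of_forall fun s => ?_)
          simp only [hFneg]
          rcases le_total (F x s) 0 with h0 | h0
          · rw [max_eq_right h0, max_eq_left (by linarith)]; ring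
          · rw [max_eq_left h0, max_eq_right (by linarith)]; ring
      have up : ∀ z x y, ∫ s, max (F z s) 0 ∂μ x ≤
          Real.exp ε * ∫ s, max (F z s) 0 ∂μ y + δ * d := fun z x y =>
        integral_le_of_measure_le hδ (h x y) (hposm z) hd0.le (fun s => le_max_right _ _)
          fun s => max_le ((le_abs_self _).trans (hFb z s)) hd0.le
      have h1 := up x x 1
      have h2 := up (-x) 1 x
      have hsum : ∫ s, max (F x s) 0 ∂μ 1 + ∫ s, max (F (-x) s) 0 ∂μ 1 ≤
          √d * ((∫ s, Real.exp (F x s / √d) ∂μ 1 + ∫ s, Real.exp (F (-x) s / √d) ∂μ 1) / 2) := by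
        rw [← integral_add (hpi x 1) (hpi (-x) 1), ← integral_add (hEi x 1) (hEi (-x) 1),
          ← integral_div, ← integral_const_mul]
        refine integral_mono ((hpi x 1).add (hpi (-x) 1))
          ((((hEi x 1).add (hEi (-x) 1)).div_const 2).const_mul _) fun s => ?_
        simp only [hFneg, neg_div, ← Real.cosh_eq]
        have hy : F x s = √d * (F x s / √d) := by field_simp
        have habs : max (F x s) 0 + max (-F x s) 0 = |F x s| := by
          rcases le_total (F x s) 0 with h0 | h0
          · rw [max_eq_right h0, max_eq_left (by linarith), abs_of_nonpos h0]; ring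
          · rw [max_eq_left h0, max_eq_right (by linarith), abs_of_nonneg h0]; ring
        rw [habs]
        conv_lhs => rw [hy, abs_mul, abs_of_pos hr]
        refine mul_le_mul_of_nonneg_left ?_ hr.le
        rw [← Real.cosh_abs]
        have h3 := Real.sinh_lt_cosh |F x s / √d|
        exact (Real.self_le_sinh_iff.2 (abs_nonneg _)).trans h3.le
      rw [dec x, dec 1]
      have p1 : 0 ≤ ∫ s, max (F x s) 0 ∂μ 1 := integral_nonneg fun s => le_max_right _ _
      have p2 : 0 ≤ ∫ s, max (F (-x) s) 0 ∂μ 1 := integral_nonneg fun s => le_max_right _ _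
      have p3 : 0 ≤ ∫ s, max (F (-x) s) 0 ∂μ x := integral_nonneg fun s => le_max_right _ _
      have hδd : 0 ≤ δ * d := by positivity
      generalize ∫ s, max (F x s) 0 ∂μ x = a at *
      generalize ∫ s, max (F x s) 0 ∂μ 1 = b at *
      generalize ∫ s, max (F (-x) s) 0 ∂μ 1 = b' at *
      generalize ∫ s, max (F (-x) s) 0 ∂μ x = a' at *
      have e1 : (Real.exp ε - 1) * (b + b') ≤ 2 * ε * (b + b') :=
        mul_le_mul_of_nonneg_right hexp (by linarith)
      have e2 := mul_le_mul_of_nonneg_left hsum (by linarith : 0 ≤ 2 * ε)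
      have e3 : 0 ≤ (Real.exp ε - 1) * δ * d := by
        have : 0 ≤ Real.exp ε - 1 := by linarith
        positivity
      -- Privacy gives `a' ≥ exp (-ε) (b' - δd)`. The claim follows since `exp (-ε) ≥ 2 - exp ε`,
      -- which amounts to `(exp ε - 1)² ≥ 0`.
      have e4 : b' - (Real.exp ε - 1) * b' - δ * d ≤ a' := by
        by_contra hcon
        push Not at hcon
        have : Real.exp ε * a' < Real.exp ε * (b' - (Real.exp ε - 1) * b' - δ * d) :=
          mul_lt_mul_of_pos_left hcon (Real.exp_pos _)
        nlinarith [mul_nonneg (sq_nonneg (Real.exp ε - 1)) p2]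
      nlinarith
    have hnegsum : ∑ x, ∫ s, Real.exp (F (-x) s / √d) ∂μ 1
        = ∑ x, ∫ s, Real.exp (F x s / √d) ∂μ 1 :=
      Equiv.sum_comp (Equiv.neg (SignCube d)) fun x => ∫ s, Real.exp (F x s / √d) ∂μ 1
    refine (Finset.sum_le_sum fun x _ => step x).trans ?_
    rw [Finset.sum_add_distrib, Finset.sum_add_distrib, hzero, ← Finset.mul_sum,
      ← Finset.mul_sum, ← Finset.sum_div, Finset.sum_add_distrib, hnegsum, Finset.sum_const,
      Finset.card_univ, nsmul_eq_mul, hcard]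
    have := mul_le_mul_of_nonneg_left hEsum (by positivity : 0 ≤ 2 * ε * √d)
    nlinarith
  -- The excess over `ε√d` is at most `√d * exp (F / √d - ε)`, whose factor `exp (-ε)` cancels the
  -- privacy loss `exp ε`.
  · have step : ∀ x, ∫ s, F x s ∂μ x ≤ ε * √d + √d * ∫ s, Real.exp (F x s / √d) ∂μ 1 + δ * d :=
      fun x => by
      have hm : Measurable fun s => max (F x s - ε * √d) 0 :=
        ((hFm x).sub_const _).max measurable_const
      have hb : ∀ s, max (F x s - ε * √d) 0 ≤ d := fun s =>
        max_le (by have := (abs_le.1 (hFb x s)).2; nlinarith) hd0.le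
      have hi : ∀ y, Integrable (fun s => max (F x s - ε * √d) 0) (μ y) := fun y =>
        bdd _ d y hm fun s => by rw [abs_of_nonneg (le_max_right _ _)]; exact hb s
      have h1 : ∫ s, F x s ∂μ x ≤ ε * √d + ∫ s, max (F x s - ε * √d) 0 ∂μ x := by
        have := integral_mono (hFi x x) ((integrable_const (ε * √d)).add (hi x))
          (fun s => by
            show F x s ≤ ε * √d + max (F x s - ε * √d) 0
            linarith [le_max_left (F x s - ε * √d) 0])
        simpa [integral_add (integrable_const (ε * √d)) (hi x)] using this
      have h2 := integral_le_of_measure_le hδ (h x 1) hm hd0.le (fun s => le_max_right _ _) hb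
      have h3 : Real.exp ε * ∫ s, max (F x s - ε * √d) 0 ∂μ 1
          ≤ √d * ∫ s, Real.exp (F x s / √d) ∂μ 1 := by
        rw [← integral_const_mul, ← integral_const_mul]
        refine integral_mono ((hi 1).const_mul _) ((hEi x 1).const_mul _) fun s => ?_
        have hy : F x s - ε * √d = √d * (F x s / √d - ε) := by field_simp
        have hle : max (F x s - ε * √d) 0 ≤ √d * Real.exp (F x s / √d - ε) := by
          refine max_le ?_ (by positivity)
          rw [hy]
          exact mul_le_mul_of_nonneg_left
            (by linarith [Real.add_one_le_exp (F x s / √d - ε)]) hr.le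
        refine (mul_le_mul_of_nonneg_left hle (Real.exp_pos ε).le).trans_eq ?_
        rw [Real.exp_sub]
        field_simp
      linarith
    refine (Finset.sum_le_sum fun x _ => step x).trans ?_
    rw [Finset.sum_add_distrib, Finset.sum_add_distrib, Finset.sum_const, Finset.sum_const,
      ← Finset.mul_sum, Finset.card_univ, nsmul_eq_mul, nsmul_eq_mul, hcard]
    have := mul_le_mul_of_nonneg_left hEsum hr.le
    have hN : (0 : ℝ) < 2 ^ d := by positivity
    have h4 : 2 ^ d * √d * 1 ≤ 2 ^ d * √d * ε := mul_le_mul_of_nonneg_left hε1 (by positivity)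
    have h5 : 0 ≤ 2 ^ d * (δ * d) := by positivity
    nlinarith

/-! ### Splitting the run of an online algorithm -/

namespace OnlineAlgorithm

variable {X S O : Type*} [MeasurableSpace X] [MeasurableSpace S] [MeasurableSpace O]
  (M : OnlineAlgorithm X S O)

theorem evolve_append (l l' : List X) (i : ℕ) :
    M.evolve i (l ++ l') = M.evolve (i + l.length) l' ∘ₖ M.evolve i l := by
  induction l generalizing i with
  | nil => simp [evolve]
  | cons x l ih =>
    rw [List.cons_append, evolve, evolve, ih, Kernel.comp_assoc, List.length_cons,
      show i + 1 + l.length = i + (l.length + 1) by ring]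

theorem stateLaw_append {l : List X} (hl : l ≠ []) (l' : List X) :
    M.stateLaw (l ++ l') = M.evolve l.length l' ∘ₘ M.stateLaw l := by
  cases l with
  | nil => exact absurd rfl hl
  | cons x l =>
    rw [List.cons_append, stateLaw, stateLaw, evolve_append, Measure.comp_assoc, List.length_cons,
      add_comm]

/-- The probability of the output event `A` when the stream `l` remains to be processed from the
state `s` reached after `i` data points. -/
noncomputable def tailProb (A : Set O) (i : ℕ) (l : List X) (s : S) : ℝ :=
  ((M.out ∘ₖ M.evolve i l) s).real A

theorem isMarkovKernel_tail (i : ℕ) (l : List X) : IsMarkovKernel (M.out ∘ₖ M.evolve i l) := by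
  have := M.isMarkovKernel_evolve l i
  have := M.markov_out
  infer_instance

theorem tailProb_mem_Icc (A : Set O) (i : ℕ) (l : List X) (s : S) :
    M.tailProb A i l s ∈ Set.Icc 0 1 := by
  have := M.isMarkovKernel_tail i l
  exact ⟨measureReal_nonneg, measureReal_le_one⟩

theorem measurable_tailProb {A : Set O} (hA : MeasurableSet A) (i : ℕ) (l : List X) :
    Measurable (M.tailProb A i l) :=
  (Kernel.measurable_coe _ hA).ennreal_toReal

theorem outputLaw_append_real {l : List X} (hl : l ≠ []) (l' : List X) {A : Set O}
    (hA : MeasurableSet A) :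
    (M.outputLaw (l ++ l')).real A = ∫ s, M.tailProb A l.length l' s ∂M.stateLaw l := by
  have := M.isMarkovKernel_tail l.length l'
  rw [outputLaw, M.stateLaw_append hl, Measure.comp_assoc, Measure.real,
    Measure.bind_apply hA (Kernel.aemeasurable _)]
  exact (integral_toReal (Kernel.measurable_coe _ hA).aemeasurable
    (.of_forall fun s => measure_lt_top _ _)).symm

theorem isProbabilityMeasure_outputLaw {l : List X} (hl : l ≠ []) :
    IsProbabilityMeasure (M.outputLaw l) := by
  have := M.isProbabilityMeasure_stateLaw hl
  have := M.markov_out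
  unfold outputLaw
  infer_instance

theorem isProbabilityMeasure_stateLaw_concat (l : List X) (x : X) :
    IsProbabilityMeasure (M.stateLaw (l ++ [x])) :=
  M.isProbabilityMeasure_stateLaw (by simp)

/-- Both prefixes are padded by the same tail to length `n`, giving streams that can differ only at
index `l.length`. Pan-privacy at time `l.length + 1` is then applied to `A ×ˢ univ`, which forgets
the output. -/
theorem IsPanPrivate.stateLaw_le [DecidableEq X] {M : OnlineAlgorithm X S O} {n : ℕ} {ε δ : ℝ}
    (hM : M.IsPanPrivate n ε δ) {l : List X} (hl : l.length < n) (x y : X) {A : Set S}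
    (hA : MeasurableSet A) :
    M.stateLaw (l ++ [x]) A ≤
      ENNReal.ofReal (Real.exp ε) * M.stateLaw (l ++ [y]) A + ENNReal.ofReal δ := by
  have hlen : ∀ z : X, (l ++ [z] ++ List.replicate (n - l.length - 1) x).length = n := fun z => by
    simp; omega
  let w : X → Fin n → X := fun z i =>
    (l ++ [z] ++ List.replicate (n - l.length - 1) x).get (i.cast (hlen z).symm)
  have hw : ∀ z, List.ofFn (w z) = l ++ [z] ++ List.replicate (n - l.length - 1) x := fun z => by
    refine List.ext_get (by simpa using (hlen z).symm) fun i h1 h2 => ?_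
    simp [w]
  have htake : ∀ z, (List.ofFn (w z)).take (l.length + 1) = l ++ [z] := fun z => by
    rw [hw, List.take_append_of_le_length (by simp)]
    simp
  have hdist : hammingDist (w x) (w y) ≤ 1 := by
    refine Finset.card_le_one.2 fun i hi j hj => ?_
    have hpos : ∀ i : Fin n, w x i ≠ w y i → (i : ℕ) = l.length := fun i hi => by
      by_contra hne
      refine hi ?_
      simp only [w, List.get_eq_getElem, Fin.val_cast, List.append_assoc]
      rcases lt_or_gt_of_ne hne with h | h
      · rw [List.getElem_append_left h, List.getElem_append_left h]
      · rw [List.getElem_append_right h.le, List.getElem_append_right h.le]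
        obtain ⟨k, hk⟩ : ∃ k, (i : ℕ) - l.length = k + 1 := ⟨i - l.length - 1, by omega⟩
        simp [hk]
    simp only [Finset.mem_filter, Finset.mem_univ, true_and] at hi hj
    exact Fin.ext ((hpos i hi).trans (hpos j hj).symm)
  have hview : ∀ z, M.viewLaw (List.ofFn (w z)) (l.length + 1) (A ×ˢ Set.univ)
      = M.stateLaw (l ++ [z]) A := fun z => by
    have := M.isProbabilityMeasure_stateLaw_concat l z
    have := M.isMarkovKernel_tail (l.length + 1) ((List.ofFn (w z)).drop (l.length + 1))
    rw [viewLaw, htake, Measure.compProd_apply_prod hA MeasurableSet.univ]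
    simp
  have := hM (w x) (w y) hdist (l.length + 1) (by omega) hl (A ×ˢ Set.univ)
    (hA.prod MeasurableSet.univ)
  rwa [hview, hview] at this

end OnlineAlgorithm

/-! ### Distributions with one biased coordinate -/

/-- The probability of `x` under the product distribution on the cube whose `j`-th coordinate has
mean `r` and whose other coordinates have mean zero. -/
noncomputable def biasedWeight {d : ℕ} (j : Fin d) (r : ℝ) (x : SignCube d) : ℝ :=
  (1 + r * ((x j : ℤ) : ℝ)) / 2 ^ d

section Biased

variable {d : ℕ} (j : Fin d) {r : ℝ}

theorem biasedWeight_nonneg (hr : |r| ≤ 1) (x : SignCube d) : 0 ≤ biasedWeight j r x := by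
  have h : |r * ((x j : ℤ) : ℝ)| ≤ 1 := by rwa [abs_mul, abs_sign_cast, mul_one]
  have := (abs_le.1 h).1
  unfold biasedWeight
  have : 0 ≤ 1 + r * ((x j : ℤ) : ℝ) := by linarith
  positivity

theorem sum_biasedWeight (r : ℝ) : ∑ x, biasedWeight j r x = 1 := by
  simp only [biasedWeight, ← Finset.sum_div, Finset.sum_add_distrib, ← Finset.mul_sum,
    sum_signs_eq_zero, Finset.sum_const, Finset.card_univ, nsmul_eq_mul, card_signCube]
  field_simp
  ring

/-- Flipping the `i`-th sign permutes the cube and negates the summand. -/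
theorem sum_signs_mul {i : Fin d} (h : i ≠ j) :
    ∑ x : SignCube d, ((x i : ℤ) : ℝ) * ((x j : ℤ) : ℝ) = 0 := by
  have key := Equiv.sum_comp (Equiv.mulLeft (Pi.mulSingle i (-1) : SignCube d))
    (fun x : SignCube d => ((x i : ℤ) : ℝ) * ((x j : ℤ) : ℝ))
  simp only [Equiv.coe_mulLeft, Pi.mul_apply, Pi.mulSingle_eq_same,
    Pi.mulSingle_eq_of_ne h.symm, neg_mul, one_mul, Units.val_neg, Int.cast_neg,
    Finset.sum_neg_distrib] at key
  linarith

theorem sum_biasedWeight_mul (r : ℝ) (i : Fin d) :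
    ∑ x, biasedWeight j r x * ((x i : ℤ) : ℝ) = if i = j then r else 0 := by
  have hx : ∀ x : SignCube d, biasedWeight j r x * ((x i : ℤ) : ℝ) =
      (((x i : ℤ) : ℝ) + r * (((x i : ℤ) : ℝ) * ((x j : ℤ) : ℝ))) / 2 ^ d := fun x => by
    rw [biasedWeight]; ring
  simp only [hx, ← Finset.sum_div, Finset.sum_add_distrib, ← Finset.mul_sum, sum_signs_eq_zero]
  split_ifs with h
  · subst h
    have hsq : ∀ x : SignCube d, ((x i : ℤ) : ℝ) * ((x i : ℤ) : ℝ) = 1 := fun x => by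
      rw [← abs_mul_abs_self, abs_sign_cast, one_mul]
    simp only [hsq, Finset.sum_const, Finset.card_univ, nsmul_eq_mul, card_signCube]
    field_simp
    ring
  · rw [sum_signs_mul j h]; simp

/-- The distribution on the cube with weights `biasedWeight j r`. -/
noncomputable def biasedMeasure (j : Fin d) (r : ℝ) : Measure (SignCube d) :=
  ∑ x, ENNReal.ofReal (biasedWeight j r x) • Measure.dirac x

theorem biasedMeasure_singleton (r : ℝ) (x : SignCube d) :
    biasedMeasure j r {x} = ENNReal.ofReal (biasedWeight j r x) := by
  simp [biasedMeasure, Measure.finsetSum_apply, Set.indicator_apply]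

theorem isProbabilityMeasure_biasedMeasure (hr : |r| ≤ 1) :
    IsProbabilityMeasure (biasedMeasure j r) := by
  constructor
  simp only [biasedMeasure, Measure.finsetSum_apply, Measure.smul_apply, measure_univ, smul_eq_mul,
    mul_one]
  rw [← ENNReal.ofReal_sum_of_nonneg fun x _ => biasedWeight_nonneg j hr x, sum_biasedWeight,
    ENNReal.ofReal_one]

theorem signMean_biasedMeasure (hr : |r| ≤ 1) (i : Fin d) :
    signMean (biasedMeasure j r) i = if i = j then r else 0 := by
  have := isProbabilityMeasure_biasedMeasure j hr
  rw [signMean, integral_fintype (Integrable.of_finite), ← sum_biasedWeight_mul j r i]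
  refine Finset.sum_congr rfl fun x _ => ?_
  rw [Measure.real, biasedMeasure_singleton, ENNReal.toReal_ofReal (biasedWeight_nonneg j hr x),
    smul_eq_mul]

theorem ncard_support_signMean_biasedMeasure (hr : |r| ≤ 1) :
    (Function.support (signMean (biasedMeasure j r))).ncard ≤ 1 := by
  have hsub : Function.support (signMean (biasedMeasure j r)) ⊆ {j} := fun i hi => by
    by_contra hij
    exact hi (by rw [signMean_biasedMeasure j hr, if_neg (by simpa using hij)])
  exact (Set.ncard_le_ncard hsub).trans (Set.ncard_singleton j).le

theorem lintegral_pi_biasedMeasure (hr : |r| ≤ 1) (n : ℕ) {f : List (SignCube d) → ℝ}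
    (hf : ∀ l, 0 ≤ f l) :
    ∫⁻ x, ENNReal.ofReal (f (List.ofFn x)) ∂(Measure.pi fun _ : Fin n => biasedMeasure j r)
      = ENNReal.ofReal (streamSum (biasedWeight j r) n f) := by
  have := isProbabilityMeasure_biasedMeasure j hr
  rw [lintegral_fintype, streamSum_eq_sum, ENNReal.ofReal_sum_of_nonneg fun x _ =>
    mul_nonneg (Finset.prod_nonneg fun i _ => biasedWeight_nonneg j hr _) (hf _)]
  refine Finset.sum_congr rfl fun x _ => ?_
  rw [Measure.pi_singleton, mul_comm,
    ENNReal.ofReal_mul (Finset.prod_nonneg fun i _ => biasedWeight_nonneg j hr _),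
    ENNReal.ofReal_prod_of_nonneg fun i _ => biasedWeight_nonneg j hr _]
  simp only [biasedMeasure_singleton]

end Biased

/-- The outputs whose `j`-th coordinate has sign `b` and absolute value at least `α`. -/
def largeOutput {d : ℕ} (α : ℝ) (j : Fin d) (b : ℤˣ) : Set (Fin d → Set.Icc (-1 : ℝ) 1) :=
  {v | α ≤ ((b : ℤ) : ℝ) * (v j : ℝ)}

theorem measurableSet_largeOutput {d : ℕ} (α : ℝ) (j : Fin d) (b : ℤˣ) :
    MeasurableSet (largeOutput α j b) :=
  measurableSet_le measurable_const
    ((measurable_subtype_coe.comp (measurable_pi_apply j)).const_mul _)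

theorem disjoint_largeOutput {d : ℕ} {α : ℝ} (hα : 0 < α) (j : Fin d) :
    Disjoint (largeOutput α j 1) (largeOutput α j (-1)) := by
  refine Set.disjoint_left.2 fun v h1 h2 => ?_
  simp only [largeOutput, Set.mem_ofPred_eq, Units.val_one, Units.val_neg, Int.cast_one,
    Int.cast_neg] at h1 h2
  linarith

/-- The bias is `2α` because an error of at most `α` at coordinate `j` then leaves an output of the
correct sign and of size at least `α`. -/
theorem SolvesSparseMean.le_streamSum {S : Type*} [MeasurableSpace S] {d : ℕ}
    {M : OnlineAlgorithm (SignCube d) S (Fin d → Set.Icc (-1 : ℝ) 1)} {α : ℝ} {n : ℕ}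
    (hM : SolvesSparseMean M 1 α n) (hn : 1 ≤ n) (hα : 0 < α) (hα' : α < 1 / 2) (j : Fin d)
    (b : ℤˣ) :
    99 / 100 ≤ streamSum (biasedWeight j (2 * α * ((b : ℤ) : ℝ))) n
      (fun l => (M.outputLaw l).real (largeOutput α j b)) := by
  have hr : |2 * α * ((b : ℤ) : ℝ)| ≤ 1 := by
    rw [abs_mul, abs_sign_cast, mul_one, abs_of_pos (by linarith)]; linarith
  have h := hM (biasedMeasure j (2 * α * ((b : ℤ) : ℝ)))
    (isProbabilityMeasure_biasedMeasure j hr) (ncard_support_signMean_biasedMeasure j hr)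
  have hle := h.trans (lintegral_mono (g := fun x => ENNReal.ofReal
      ((M.outputLaw (List.ofFn x)).real (largeOutput α j b))) fun x => ?_)
  · rw [lintegral_pi_biasedMeasure j hr n
      (f := fun l => (M.outputLaw l).real (largeOutput α j b)) fun _ => measureReal_nonneg] at hle
    have h0 : (99 / 100 : ENNReal) = ENNReal.ofReal (99 / 100) := by
      rw [ENNReal.ofReal_div_of_pos (by norm_num)]; norm_num
    rw [h0] at hle
    by_contra hcon
    exact absurd hle (not_le.2 ((ENNReal.ofReal_lt_ofReal_iff (by norm_num)).2 (not_le.1 hcon)))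
  · have := M.isProbabilityMeasure_outputLaw (l := List.ofFn x)
      (by rw [← List.length_pos_iff, List.length_ofFn]; exact hn)
    simp only [ofReal_measureReal (measure_ne_top _ _)]
    refine measure_mono fun v hv => ?_
    have h1 := (norm_le_pi_norm _ j).trans hv
    rw [Pi.sub_apply, signMean_biasedMeasure j hr, if_pos rfl, Real.norm_eq_abs, abs_le] at h1
    rcases Int.units_eq_one_or b with rfl | rfl <;>
    · simp only [largeOutput, Set.mem_ofPred_eq, Units.val_one, Units.val_neg, Int.cast_one,
        Int.cast_neg] at h1 ⊢
      linarith [h1.1, h1.2]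

/-! ### The lower bound -/

/-- Replacing the distribution of a single element of the stream by the uniform one changes the
success probabilities little on average over the biased distributions. -/
theorem sum_hybrid_le {S : Type*} [MeasurableSpace S] {d : ℕ} (hd : 1 ≤ d)
    {M : OnlineAlgorithm (SignCube d) S (Fin d → Set.Icc (-1 : ℝ) 1)} {α ε δ : ℝ} {n : ℕ}
    (hα : 0 < α) (hα' : α < 1 / 2) (hε : 0 < ε) (hδ : 0 ≤ δ) (hM : M.IsPanPrivate n ε δ)
    {t : ℕ} (ht : t < n) (m : ℕ) :
    ∑ j, ∑ b : ℤˣ, streamSum (fun _ => 1 / 2 ^ d) t (fun l =>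
      ∑ x, (biasedWeight j (2 * α * ((b : ℤ) : ℝ)) x - 1 / 2 ^ d) *
        streamSum (biasedWeight j (2 * α * ((b : ℤ) : ℝ))) m
          (fun l' => (M.outputLaw ((l ++ [x]) ++ l')).real (largeOutput α j b)))
      ≤ 2 * α * (4 * ε * √d + 2 * δ * d) := by
  have hr : ∀ b : ℤˣ, |2 * α * ((b : ℤ) : ℝ)| ≤ 1 := fun b => by
    rw [abs_mul, abs_sign_cast, mul_one, abs_of_pos (by linarith)]; linarith
  have hu : ∑ _x : SignCube d, (1 / 2 ^ d : ℝ) = 1 := by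
    rw [Finset.sum_const, Finset.card_univ, nsmul_eq_mul, card_signCube]; field_simp
  have hN : (0 : ℝ) < 2 ^ d := by positivity
  simp only [← streamSum_sum]
  rw [← streamSum_const hu t (2 * α * (4 * ε * √d + 2 * δ * d))]
  refine streamSum_mono (fun _ => by positivity) fun l hl => ?_
  have := M.isProbabilityMeasure_stateLaw_concat l
  -- The success probability continued from state `s` when the remaining `m` elements are drawn from
  -- the biased distribution.
  let G : Fin d → ℤˣ → S → ℝ := fun j b s =>
    streamSum (biasedWeight j (2 * α * ((b : ℤ) : ℝ))) m
      (fun l' => M.tailProb (largeOutput α j b) (t + 1) l' s)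
  have hGm : ∀ j b, Measurable (G j b) := fun j b => measurable_streamSum _ fun l' =>
    M.measurable_tailProb (measurableSet_largeOutput α j b) _ _
  have hG01 : ∀ j b s, G j b s ∈ Set.Icc 0 1 := fun j b s =>
    streamSum_mem_Icc (biasedWeight_nonneg j (hr b)) (sum_biasedWeight j _)
      fun l' => M.tailProb_mem_Icc _ _ _ _
  have hGi : ∀ j b x, Integrable (G j b) (M.stateLaw (l ++ [x])) := fun j b x =>
    Integrable.of_bound (hGm j b).aestronglyMeasurable 1 (.of_forall fun s => by
      rw [Real.norm_of_nonneg (hG01 j b s).1]; exact (hG01 j b s).2)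
  have hGint : ∀ (j : Fin d) (b : ℤˣ) (x : SignCube d), streamSum (biasedWeight j (2 * α * ((b : ℤ) : ℝ))) m
      (fun l' => (M.outputLaw ((l ++ [x]) ++ l')).real (largeOutput α j b))
        = ∫ s, G j b s ∂M.stateLaw (l ++ [x]) := fun j b x => by
    have hlen : (l ++ [x]).length = t + 1 := by simp [hl]
    rw [← streamSum_integral]
    · refine streamSum_congr _ fun l' _ => ?_
      rw [M.outputLaw_append_real (by simp) l' (measurableSet_largeOutput α j b), hlen]
    · refine fun l' => Integrable.of_bound
        (M.measurable_tailProb (measurableSet_largeOutput α j b) _ _).aestronglyMeasurable 1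
        (.of_forall fun s => ?_)
      rw [Real.norm_of_nonneg (M.tailProb_mem_Icc _ _ _ _).1]
      exact (M.tailProb_mem_Icc _ _ _ _).2
  -- The two signs `b` enter with opposite coefficients, so only the difference of the two `G`'s
  -- matters; it lies in `[-1, 1]`.
  have core := sum_signs_integral_le hd (μ := fun x => M.stateLaw (l ++ [x])) hε hδ
    (fun x y A hA => hM.stateLaw_le (hl ▸ ht) x y hA)
    (g := fun j s => G j 1 s - G j (-1) s) (fun j => (hGm j 1).sub (hGm j (-1)))
    (fun j s => abs_le.2 ⟨by linarith [(hG01 j 1 s).1, (hG01 j (-1) s).2],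
      by linarith [(hG01 j 1 s).2, (hG01 j (-1) s).1]⟩)
  -- Here `biasedWeight - 1 / 2 ^ d` equals `2αb x_j / 2 ^ d`: the linear coefficient `x_j` is what
  -- the correlation bound requires.
  have heq : ∑ j, ∑ b : ℤˣ, ∑ x, (biasedWeight j (2 * α * ((b : ℤ) : ℝ)) x - 1 / 2 ^ d) *
      streamSum (biasedWeight j (2 * α * ((b : ℤ) : ℝ))) m
        (fun l' => (M.outputLaw ((l ++ [x]) ++ l')).real (largeOutput α j b))
      = 2 * α / 2 ^ d * ∑ x, ∑ j, ((x j : ℤ) : ℝ) *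
          ∫ s, (G j 1 s - G j (-1) s) ∂M.stateLaw (l ++ [x]) := by
    simp only [hGint]
    rw [Finset.sum_comm (s := (Finset.univ : Finset (SignCube d))), Finset.mul_sum]
    refine Finset.sum_congr rfl fun j _ => ?_
    rw [UnitsInt.univ, Finset.sum_pair (by decide), ← Finset.sum_add_distrib, Finset.mul_sum]
    refine Finset.sum_congr rfl fun x _ => ?_
    rw [integral_sub (hGi j 1 x) (hGi j (-1) x)]
    simp only [biasedWeight, Units.val_one, Units.val_neg, Int.cast_one, Int.cast_neg]
    ring
  rw [heq]
  calc _ ≤ 2 * α / 2 ^ d * (2 ^ d * (4 * ε * √d + 2 * δ * d)) :=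
        mul_le_mul_of_nonneg_left core (by positivity)
    _ = _ := by field_simp

theorem SolvesSparseMean.le_of_isPanPrivate {S : Type*} [MeasurableSpace S] {d : ℕ} (hd : 1 ≤ d)
    {M : OnlineAlgorithm (SignCube d) S (Fin d → Set.Icc (-1 : ℝ) 1)} {α ε δ : ℝ} {n : ℕ}
    (hn : 1 ≤ n) (hα : 0 < α) (hα' : α < 1 / 2) (hε : 0 < ε) (hδ : 0 ≤ δ)
    (hM : M.IsPanPrivate n ε δ) (hS : SolvesSparseMean M 1 α n) :
    49 / 50 * (d : ℝ) ≤ n * (2 * α * (4 * ε * √d + 2 * δ * d)) := by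
  set u : SignCube d → ℝ := fun _ => 1 / 2 ^ d with hu_def
  have hu : ∑ x, u x = 1 := by
    rw [hu_def, Finset.sum_const, Finset.card_univ, nsmul_eq_mul, card_signCube]; field_simp
  have hu0 : ∀ x, 0 ≤ u x := fun x => by positivity
  let f : Fin d → ℤˣ → List (SignCube d) → ℝ := fun j b l =>
    (M.outputLaw l).real (largeOutput α j b)
  have hlow : (d : ℝ) * (99 / 50) ≤
      ∑ j, ∑ b : ℤˣ, streamSum (biasedWeight j (2 * α * ((b : ℤ) : ℝ))) n (f j b) := by
    calc (d : ℝ) * (99 / 50) = ∑ _j : Fin d, ∑ _b : ℤˣ, (99 / 100 : ℝ) := by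
          simp [Finset.sum_const]; norm_num
      _ ≤ _ := Finset.sum_le_sum fun j _ => Finset.sum_le_sum fun b _ =>
          hS.le_streamSum hn hα hα' j b
  -- Under uniform samples the weights do not depend on `b`, so for each `j` disjointness of the two
  -- events bounds the sum over `b` by 1.
  have hup : ∑ j, ∑ b : ℤˣ, streamSum u n (f j b) ≤ d := by
    calc _ ≤ ∑ _j : Fin d, (1 : ℝ) := Finset.sum_le_sum fun j _ => ?_
      _ = d := by simp
    rw [← streamSum_sum, ← streamSum_const hu n 1]
    refine streamSum_mono hu0 fun l hl => ?_
    have := M.isProbabilityMeasure_outputLaw (l := l) (by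
      rw [← List.length_pos_iff, hl]; exact hn)
    rw [UnitsInt.univ, Finset.sum_pair (by decide), ← measureReal_union
      (disjoint_largeOutput hα j) (measurableSet_largeOutput α j (-1))]
    exact measureReal_le_one
  have hdiff : ∑ j, ∑ b : ℤˣ, (streamSum (biasedWeight j (2 * α * ((b : ℤ) : ℝ))) n (f j b)
      - streamSum u n (f j b)) ≤ n * (2 * α * (4 * ε * √d + 2 * δ * d)) := by
    simp only [streamSum_sub_eq_sum_hybrid]
    simp only [Finset.sum_comm (t := Finset.range n)]
    calc _ ≤ ∑ _t ∈ Finset.range n, (2 * α * (4 * ε * √d + 2 * δ * d)) :=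
          Finset.sum_le_sum fun t ht =>
            sum_hybrid_le hd hα hα' hε hδ hM (Finset.mem_range.1 ht) (n - 1 - t)
      _ = _ := by simp
  simp only [Finset.sum_sub_distrib] at hdiff
  linarith

theorem mainTheorem11 :
    ∃ c₀ : ℝ, 0 < c₀ ∧ ∃ c : ℝ, 0 < c ∧
      ∀ (d n : ℕ) (α ε δ : ℝ) (S : Type*) [MeasurableSpace S]
        (M : OnlineAlgorithm (SignCube d) S (Fin d → Set.Icc (-1 : ℝ) 1)),
        2 ≤ d → 1 ≤ n → 0 < α → α < 1 / 2 → 0 < ε → 0 ≤ δ → δ ≤ 1 →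
        M.IsPanPrivate n ε δ →
        SolvesSparseMean M 1 α n →
        δ * Real.log (d / δ) ≤ c₀ * (α ^ 2 * ε ^ 2 / d) →
        c * (Real.sqrt d / (α * ε)) ≤ n := by
  -- `c₀ = 1/2` matches the bound `log (d / δ) ≥ log 2 > 1/2`. The argument ends with `(49/50) √d ≤
  -- 12 n α ε`, and `12/20 < 49/50` allows `c = 1/20`.
  refine ⟨1 / 2, by norm_num, 1 / 20, by norm_num, ?_⟩
  intro d n α ε δ S _ M hd hn hα hα' hε hδ hδ1 hM hS hlog
  have hd0 : (0 : ℝ) < d := by exact_mod_cast (by omega : 0 < d)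
  have hd2 : (2 : ℝ) ≤ d := by exact_mod_cast hd
  have hn1 : (1 : ℝ) ≤ n := by exact_mod_cast hn
  have hr : 0 < √(d : ℝ) := Real.sqrt_pos.2 hd0
  have hrr : √(d : ℝ) * √d = d := Real.mul_self_sqrt hd0.le
  have hαε : 0 < α * ε := mul_pos hα hε
  rw [← mul_div_assoc, div_le_iff₀ hαε]
  -- If `√d ≤ α ε`, the bound already follows from `n ≥ 1`. The other case supplies `α ε < √d`,
  -- needed to absorb `δ`.
  rcases le_or_gt (√d) (α * ε) with hbig | hsmall
  · have := mul_le_mul_of_nonneg_right hn1 hαε.le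
    linarith
  -- The logarithm is needed only through a constant lower bound: it gives `δ d ≤ (α ε)²`, where one
  -- factor is at most `ε` and the other less than `√d`.
  have hδd : δ * d ≤ ε * √d := by
    have hlog2 : δ * (1 / 2) ≤ δ * Real.log (d / δ) := by
      rcases hδ.eq_or_lt with rfl | hpos
      · simp
      · refine mul_le_mul_of_nonneg_left ?_ hδ
        have h2 : (2 : ℝ) ≤ d / δ := by rw [le_div_iff₀ hpos]; linarith
        have := Real.log_le_log two_pos h2
        linarith [Real.log_two_gt_d9]
    have h1 : δ * (1 / 2) ≤ 1 / 2 * ((α * ε) ^ 2 / d) := by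
      rw [mul_pow]; exact hlog2.trans hlog
    have h2 : δ * d ≤ (α * ε) ^ 2 := by
      rw [← le_div_iff₀ hd0]; linarith
    have h3 : α * ε ≤ ε := by nlinarith
    calc δ * d ≤ (α * ε) ^ 2 := h2
      _ = (α * ε) * (α * ε) := sq _
      _ ≤ ε * √d := mul_le_mul h3 hsmall.le hαε.le hε.le
  have main := hS.le_of_isPanPrivate (by omega) hn hα hα' hε hδ hM
  have hub : (n : ℝ) * (2 * α * (4 * ε * √d + 2 * δ * d)) ≤ n * (12 * (α * ε)) * √d := by
    have : 4 * ε * √d + 2 * δ * d ≤ 6 * (ε * √d) := by linarith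
    have := mul_le_mul_of_nonneg_left this (by positivity : 0 ≤ (n : ℝ) * (2 * α))
    linarith
  have hfin : 49 / 50 * √(d : ℝ) ≤ n * (12 * (α * ε)) := by
    refine le_of_mul_le_mul_right ?_ hr
    rw [mul_assoc, hrr]
    exact main.trans hub
  linarith
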